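/- Let $M$ be a smooth Hausdorff manifold (without boundary) of finite dimension $n$. Regard a bivector $P$ on $M$ as a smooth skew-symmetric bundle map $P : T^*M \to TM$; it is a Poisson bivector if the bracket $\{f,g\} = dg(P(df))$ on $C^\infty(M)$ satisfies the Jacobi identity. Let $P_1, P_2$ be compatible Poisson bivectors, i.e. $P_1$, $P_2$ and $P_1+P_2$ are Poisson bivectors, assume that $P_1$ is invertible at each point, and put $R = P_2 \circ P_1^{-1} : TM \to TM$. Let $H_1, H_2 \in C^\infty(M)$ and let $X$ be a vector field with $$X = P_1(dH_1) = P_2(dH_2).$$ Put $\theta = dH_1$. For a $1$-form $\theta$ and a $(1,1)$-tensor $R$, let $\theta R$ denote the $1$-form $Y \mapsto \theta(RY)$. A Magri–Lenard complex on $M$ consists of $n$ smooth pairwise commuting $(1,1)$-tensors $R_1 = \mathrm{Id}, R_2, \dots, R_n$, a smooth vector field $X$ and a smooth $1$-form $\theta$ such that the vector fields $R_kX$ ($1 \le k \le n$) commute pairwise for the Lie bracket and the $1$-forms $\theta R_k R_\ell$ ($1 \le k,\ell \le n$) are closed. Then: 1. The tensors $\mathrm{Id}, R, R^2, \dots, R^{n-1}$,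 the field $X$ and the form $\theta$ form a Magri–Lenard complex. 2. For every $k \ge 0$, the tensor $R^k$ is smooth, and its Nijenhuis torsion $$\mathcal T_{S}(Y,Z) = [SY,SZ] - S[SY,Z] - S[Y,SZ] + S^2[Y,Z] \qquad (S=R^k)$$ and its Haantjes torsion $$\mathcal H_S(Y,Z) = \mathcal T_S(SY,SZ) - S\,\mathcal T_S(SY,Z) - S\,\mathcal T_S(Y,SZ) + S^2\,\mathcal T_S(Y,Z)$$ vanish. 3. For every $k \ge 0$, the vector field $R^kX$ is smooth and locally bi-hamiltonian: there are closed smooth $1$-forms $\alpha,\beta$ with $R^kX = P_1(\alpha) = P_2(\beta)$. 4. $[R^kX, R^\ell X] = 0$ for all $k, \ell \ge 0$. 5. For every $k \ge 0$, the $1$-form $\theta R^k$ is smooth and closed. 6. $\mathcal L_X\theta = 0$ and $\mathcal L_X R = 0$. -/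

import Mathlib

open scoped Manifold ContDiff

noncomputable section

namespace MagriLenard

section Fields

variable {E : Type*} [NormedAddCommGroup E] [NormedSpace ℝ E]
variable {M : Type*} [TopologicalSpace M] [ChartedSpace E M]

/-- Vector fields on `M` (not necessarily smooth). -/
abbrev VectorField (E : Type*) [NormedAddCommGroup E] [NormedSpace ℝ E]
    (M : Type*) [TopologicalSpace M] [ChartedSpace E M] : Type _ :=
  (x : M) → TangentSpace 𝓘(ℝ, E) x

/-- Fields of covectors (`1`-forms) on `M` (not necessarily smooth). -/
abbrev OneForm (E : Type*) [NormedAddCommGroup E] [NormedSpace ℝ E]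
    (M : Type*) [TopologicalSpace M] [ChartedSpace E M] : Type _ :=
  (x : M) → (TangentSpace 𝓘(ℝ, E) x →L[ℝ] ℝ)

/-- Fields of endomorphisms of the tangent spaces (`(1,1)`-tensors) on `M` (not necessarily
smooth). -/
abbrev EndField (E : Type*) [NormedAddCommGroup E] [NormedSpace ℝ E]
    (M : Type*) [TopologicalSpace M] [ChartedSpace E M] : Type _ :=
  (x : M) → (TangentSpace 𝓘(ℝ, E) x →L[ℝ] TangentSpace 𝓘(ℝ, E) x)

/-- Fields of linear maps `T*_x M → T_x M` (contravariant `2`-tensors) on `M` (not necessarily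
smooth). -/
abbrev CoTensorField (E : Type*) [NormedAddCommGroup E] [NormedSpace ℝ E]
    (M : Type*) [TopologicalSpace M] [ChartedSpace E M] : Type _ :=
  (x : M) → ((TangentSpace 𝓘(ℝ, E) x →L[ℝ] ℝ) →L[ℝ] TangentSpace 𝓘(ℝ, E) x)

variable [IsManifold 𝓘(ℝ, E) ∞ M]

/-- `V` is a smooth section of `TM`. -/
def SmoothVectorField (V : VectorField E M) : Prop :=
  ContMDiff 𝓘(ℝ, E) (𝓘(ℝ, E).prod 𝓘(ℝ, E)) ∞
    (fun x ↦ Bundle.TotalSpace.mk' E (E := fun x : M ↦ TangentSpace 𝓘(ℝ, E) x) x (V x))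

/-- `θ` is a smooth section of `T*M`. -/
def SmoothOneForm (θ : OneForm E M) : Prop :=
  ContMDiff 𝓘(ℝ, E) (𝓘(ℝ, E).prod 𝓘(ℝ, E →L[ℝ] ℝ)) ∞
    (fun x ↦ Bundle.TotalSpace.mk' (E →L[ℝ] ℝ)
      (E := fun x : M ↦ (TangentSpace 𝓘(ℝ, E) x →L[ℝ] Bundle.Trivial M ℝ x)) x (θ x))

/-- `R` is a smooth section of `Hom(TM, TM)`. -/
def SmoothEndField (R : EndField E M) : Prop :=
  ContMDiff 𝓘(ℝ, E) (𝓘(ℝ, E).prod 𝓘(ℝ, E →L[ℝ] E)) ∞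
    (fun x ↦ Bundle.TotalSpace.mk' (E →L[ℝ] E)
      (E := fun x : M ↦ (TangentSpace 𝓘(ℝ, E) x →L[ℝ] TangentSpace 𝓘(ℝ, E) x)) x (R x))

/-- `P` is a smooth section of `Hom(T*M, TM)`. -/
def SmoothCoTensorField (P : CoTensorField E M) : Prop :=
  ContMDiff 𝓘(ℝ, E) (𝓘(ℝ, E).prod 𝓘(ℝ, (E →L[ℝ] ℝ) →L[ℝ] E)) ∞
    (fun x ↦ Bundle.TotalSpace.mk' ((E →L[ℝ] ℝ) →L[ℝ] E)
      (E := fun x : M ↦ ((TangentSpace 𝓘(ℝ, E) x →L[ℝ] Bundle.Trivial M ℝ x) →L[ℝ]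
        TangentSpace 𝓘(ℝ, E) x)) x (P x))


/-- The differential `df` of a real function. -/
def differential (f : M → ℝ) : OneForm E M := fun x ↦ mfderiv 𝓘(ℝ, E) 𝓘(ℝ, ℝ) f x

/-- The directional derivative `V(f) = df(V)`. -/
def dirDeriv (V : VectorField E M) (f : M → ℝ) (x : M) : ℝ := differential (E := E) f x (V x)

/-- The Lie bracket of vector fields. -/
abbrev bracket (V W : VectorField E M) : VectorField E M :=
  VectorField.mlieBracket 𝓘(ℝ, E) V W

/-- The vector field `RV`. -/
def EndField.act (R : EndField E M) (V : VectorField E M) : VectorField E M := fun x ↦ R x (V x)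

/-- The pointwise power `R ^ k`. -/
def EndField.pow (R : EndField E M) (k : ℕ) : EndField E M := fun x ↦ (R x) ^ k

/-- The pointwise composition `R ∘ S`. -/
def EndField.comp (R S : EndField E M) : EndField E M := fun x ↦ (R x) ∘L (S x)

/-- The `1`-form `θR = ᵗR θ`, that is, `(θR)(V) = θ(RV)`. -/
def OneForm.mulEnd (θ : OneForm E M) (R : EndField E M) : OneForm E M := fun x ↦ (θ x) ∘L (R x)

/-- The vector field `P(α)`. -/
def CoTensorField.act (P : CoTensorField E M) (α : OneForm E M) : VectorField E M :=
  fun x ↦ P x (α x)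

/-- The function `θ(V)`. -/
def OneForm.pair (θ : OneForm E M) (V : VectorField E M) (x : M) : ℝ := θ x (V x)

/-- A smooth `1`-form `θ` is closed if
`dθ(V, W) = V(θ(W)) - W(θ(V)) - θ([V, W])` vanishes for all smooth vector fields `V`, `W`. -/
def IsClosedForm (θ : OneForm E M) : Prop :=
  SmoothOneForm θ ∧
  ∀ V W : VectorField E M, SmoothVectorField V → SmoothVectorField W → ∀ x : M,
    dirDeriv V (θ.pair W) x - dirDeriv W (θ.pair V) x - θ.pair (bracket V W) x = 0

/-- `L_X θ = 0`, where `(L_X θ)(V) = X(θ(V)) - θ([X, V])`. -/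
def LeavesFormInvariant (X : VectorField E M) (θ : OneForm E M) : Prop :=
  ∀ V : VectorField E M, SmoothVectorField V → ∀ x : M,
    dirDeriv X (θ.pair V) x - θ.pair (bracket X V) x = 0

/-- `L_X R = 0`, where `(L_X R)(V) = [X, RV] - R[X, V]`. -/
def LeavesEndInvariant (X : VectorField E M) (R : EndField E M) : Prop :=
  ∀ V : VectorField E M, SmoothVectorField V → ∀ x : M,
    bracket X (R.act V) x - R.act (bracket X V) x = 0

/-- The Nijenhuis torsion `T_R(V, W) = [RV, RW] - R[RV, W] - R[V, RW] + R²[V, W]`. -/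
def nijenhuisTorsion (R : EndField E M) (V W : VectorField E M) : VectorField E M :=
  fun x ↦ bracket (R.act V) (R.act W) x - R.act (bracket (R.act V) W) x
    - R.act (bracket V (R.act W)) x + R.act (R.act (bracket V W)) x

/-- The Haantjes torsion
`H_R(V, W) = T_R(RV, RW) - R(T_R(RV, W)) - R(T_R(V, RW)) + R²(T_R(V, W))`. -/
def haantjesTorsion (R : EndField E M) (V W : VectorField E M) : VectorField E M :=
  fun x ↦ nijenhuisTorsion R (R.act V) (R.act W) x - R.act (nijenhuisTorsion R (R.act V) W) x
    - R.act (nijenhuisTorsion R V (R.act W)) x + R.act (R.act (nijenhuisTorsion R V W)) x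

/-- A smooth `(1,1)`-tensor whose Nijenhuis torsion vanishes. -/
def IsNijenhuis (R : EndField E M) : Prop :=
  SmoothEndField R ∧
  ∀ V W : VectorField E M, SmoothVectorField V → SmoothVectorField W → ∀ x : M,
    nijenhuisTorsion R V W x = 0

/-- A smooth `(1,1)`-tensor whose Haantjes torsion vanishes. -/
def IsHaantjes (R : EndField E M) : Prop :=
  SmoothEndField R ∧
  ∀ V W : VectorField E M, SmoothVectorField V → SmoothVectorField W → ∀ x : M,
    haantjesTorsion R V W x = 0

/-- The bracket `{f, g} = dg(P(df))`. -/
def poissonBracket (P : CoTensorField E M) (f g : M → ℝ) : M → ℝ :=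
  dirDeriv (P.act (differential f)) g

/-- `P`, regarded as a map `T*M → TM`, is a Poisson bivector: it is smooth, skew-symmetric, and
its bracket on smooth functions satisfies the Jacobi identity. -/
structure IsPoissonBivector (P : CoTensorField E M) : Prop where
  smooth : SmoothCoTensorField P
  skew : ∀ (x : M) (α β : TangentSpace 𝓘(ℝ, E) x →L[ℝ] ℝ), β (P x α) = - α (P x β)
  jacobi : ∀ f g h : M → ℝ,
    ContMDiff 𝓘(ℝ, E) 𝓘(ℝ, ℝ) ∞ f → ContMDiff 𝓘(ℝ, E) 𝓘(ℝ, ℝ) ∞ g →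
    ContMDiff 𝓘(ℝ, E) 𝓘(ℝ, ℝ) ∞ h → ∀ x : M,
    poissonBracket P f (poissonBracket P g h) x + poissonBracket P g (poissonBracket P h f) x
      + poissonBracket P h (poissonBracket P f g) x = 0

/-- `P₁` and `P₂` are compatible Poisson bivectors: they and their sum are Poisson. -/
structure ArePoissonCompatible (P₁ P₂ : CoTensorField E M) : Prop where
  poisson₁ : IsPoissonBivector P₁
  poisson₂ : IsPoissonBivector P₂
  poisson_add : IsPoissonBivector (fun x ↦ P₁ x + P₂ x)

/-- The operator `P₂ ∘ P₁⁻¹`, meaningful where every `P₁ x` is invertible. -/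
def recursionOperator (P₁ P₂ : CoTensorField E M) : EndField E M :=
  fun x ↦ (P₂ x) ∘L (P₁ x).inverse

/-- `X` is locally hamiltonian for `P`: it is the image under `P` of a closed `1`-form. -/
def IsLocallyHamiltonian (P : CoTensorField E M) (X : VectorField E M) : Prop :=
  ∃ α : OneForm E M, IsClosedForm α ∧ X = P.act α

/-- The tensors `K 0, …, K (n - 1)` (with `n = dim M`), the vector field `X` and the `1`-form `θ`
form a Magri–Lenard complex. -/
structure IsMagriLenardComplex (K : Fin (Module.finrank ℝ E) → EndField E M)
    (X : VectorField E M) (θ : OneForm E M) : Prop where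
  smooth_K : ∀ i, SmoothEndField (K i)
  smooth_X : SmoothVectorField X
  smooth_θ : SmoothOneForm θ
  K_first : ∀ i : Fin (Module.finrank ℝ E), (i : ℕ) = 0 →
    ∀ x, K i x = ContinuousLinearMap.id ℝ (TangentSpace 𝓘(ℝ, E) x)
  K_commute : ∀ i j, (K i).comp (K j) = (K j).comp (K i)
  fields_commute : ∀ i j, ∀ x : M, bracket ((K i).act X) ((K j).act X) x = 0
  forms_closed : ∀ i j, IsClosedForm ((θ.mulEnd (K i)).mulEnd (K j))

end Fields

end MagriLenard

end

/-! Jacobi for a Poisson bivector `P` says `[P df, P dg] = P d{f,g}`; subtracting this identity for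
`P₁` and `P₂` from the one for `P₁ + P₂` leaves a mixed identity (`bracket_add_bracket`). Since `P₁`
is invertible, the values of the fields `P₁ df` fill each tangent space, and both the torsion of `R`
and `L_X R` are tensorial. They may thus be tested on such fields, where `R (P₁ df) = P₂ df`: the
mixed identity kills the torsion, and `L_X R = 0` holds because `{H₁,f}₁ = X f = {H₂,f}₂`.

The rest is algebra. Vanishing torsion passes to powers and expresses `[R^k X, R^l X]` through
brackets `[X, R^j X]`, which vanish by `L_X R = 0`. It also makes all `dH₂ R^k` closed once `dH₂`
and `dH₂ R` are, and `dH₂ R = θ` by injectivity of `P₁`. Skew-symmetry moves `R` across each `Pᵢ`,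
so `R^k X = P₁(θ R^k) = P₂(dH₂ R^k)`. -/

/-! ### Smoothness of composition and inversion in hom-bundles. -/

section HomBundle

open Bundle ContinuousLinearMap

variable {𝕜 B F₁ F₂ F₃ : Type*} [NontriviallyNormedField 𝕜] {n : WithTop ℕ∞}
  {E₁ : B → Type*}
  [∀ x, AddCommGroup (E₁ x)] [∀ x, Module 𝕜 (E₁ x)] [NormedAddCommGroup F₁] [NormedSpace 𝕜 F₁]
  [TopologicalSpace (TotalSpace F₁ E₁)] [∀ x, TopologicalSpace (E₁ x)]
  {E₂ : B → Type*} [∀ x, AddCommGroup (E₂ x)]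
  [∀ x, Module 𝕜 (E₂ x)] [NormedAddCommGroup F₂] [NormedSpace 𝕜 F₂]
  [TopologicalSpace (TotalSpace F₂ E₂)] [∀ x, TopologicalSpace (E₂ x)]
  {E₃ : B → Type*} [∀ x, AddCommGroup (E₃ x)]
  [∀ x, Module 𝕜 (E₃ x)] [NormedAddCommGroup F₃] [NormedSpace 𝕜 F₃]
  [TopologicalSpace (TotalSpace F₃ E₃)] [∀ x, TopologicalSpace (E₃ x)]
  {EB : Type*}
  [NormedAddCommGroup EB] [NormedSpace 𝕜 EB] {HB : Type*} [TopologicalSpace HB]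
  {IB : ModelWithCorners 𝕜 EB HB} [TopologicalSpace B] [ChartedSpace HB B]
  [FiberBundle F₁ E₁] [VectorBundle 𝕜 F₁ E₁]
  [FiberBundle F₂ E₂] [VectorBundle 𝕜 F₂ E₂]
  [FiberBundle F₃ E₃] [VectorBundle 𝕜 F₃ E₃]

/-- The fiberwise composition of `C^n` sections of hom-bundles is `C^n`. -/
theorem ContMDiff.clm_bundle_comp
    [∀ x, IsTopologicalAddGroup (E₂ x)] [∀ x, ContinuousSMul 𝕜 (E₂ x)]
    [∀ x, IsTopologicalAddGroup (E₃ x)] [∀ x, ContinuousSMul 𝕜 (E₃ x)]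
    {ψ : ∀ x, E₂ x →L[𝕜] E₃ x} {ϕ : ∀ x, E₁ x →L[𝕜] E₂ x}
    (hψ : ContMDiff IB (IB.prod 𝓘(𝕜, F₂ →L[𝕜] F₃)) n
      (fun x ↦ TotalSpace.mk' (F₂ →L[𝕜] F₃) (E := fun x ↦ E₂ x →L[𝕜] E₃ x) x (ψ x)))
    (hϕ : ContMDiff IB (IB.prod 𝓘(𝕜, F₁ →L[𝕜] F₂)) n
      (fun x ↦ TotalSpace.mk' (F₁ →L[𝕜] F₂) (E := fun x ↦ E₁ x →L[𝕜] E₂ x) x (ϕ x))) :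
    ContMDiff IB (IB.prod 𝓘(𝕜, F₁ →L[𝕜] F₃)) n
      (fun x ↦ TotalSpace.mk' (F₁ →L[𝕜] F₃) (E := fun x ↦ E₁ x →L[𝕜] E₃ x) x
        ((ψ x).comp (ϕ x))) := by
  intro x₀
  have h₁ := (contMDiffAt_hom_bundle _).1 (hψ x₀)
  have h₂ := (contMDiffAt_hom_bundle _).1 (hϕ x₀)
  refine (contMDiffAt_hom_bundle _).2 ⟨h₁.1, ?_⟩
  refine (h₁.2.clm_comp h₂.2).congr_of_eventuallyEq ?_
  filter_upwards [(trivializationAt F₂ E₂ x₀).open_baseSet.mem_nhds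
    (FiberBundle.mem_baseSet_trivializationAt' x₀)] with x hx
  ext v
  simp [inCoordinates, hx]

/-- The fiberwise inverse of a `C^n` section of a hom-bundle, all of whose values are invertible,
is `C^n`. -/
theorem ContMDiff.clm_bundle_inverse [CompleteSpace F₁]
    [∀ x, IsTopologicalAddGroup (E₁ x)] [∀ x, ContinuousSMul 𝕜 (E₁ x)]
    [∀ x, IsTopologicalAddGroup (E₂ x)] [∀ x, ContinuousSMul 𝕜 (E₂ x)]
    {ϕ : ∀ x, E₁ x →L[𝕜] E₂ x} (hinv : ∀ x, (ϕ x).IsInvertible)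
    (hϕ : ContMDiff IB (IB.prod 𝓘(𝕜, F₁ →L[𝕜] F₂)) n
      (fun x ↦ TotalSpace.mk' (F₁ →L[𝕜] F₂) (E := fun x ↦ E₁ x →L[𝕜] E₂ x) x (ϕ x))) :
    ContMDiff IB (IB.prod 𝓘(𝕜, F₂ →L[𝕜] F₁)) n
      (fun x ↦ TotalSpace.mk' (F₂ →L[𝕜] F₁) (E := fun x ↦ E₂ x →L[𝕜] E₁ x) x
        (ϕ x).inverse) := by
  intro x₀
  have h := (contMDiffAt_hom_bundle _).1 (hϕ x₀)
  refine (contMDiffAt_hom_bundle _).2 ⟨h.1, ?_⟩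
  have m₁ := FiberBundle.mem_baseSet_trivializationAt' (F := F₁) (E := E₁) x₀
  have m₂ := FiberBundle.mem_baseSet_trivializationAt' (F := F₂) (E := E₂) x₀
  have hi : (inCoordinates F₁ E₁ F₂ E₂ x₀ x₀ x₀ x₀ (ϕ x₀)).IsInvertible := by
    rw [inCoordinates_eq m₁ m₂]
    obtain ⟨e, he⟩ := hinv x₀
    rw [← he]
    exact ⟨(((trivializationAt F₁ E₁ x₀).continuousLinearEquivAt 𝕜 x₀ m₁).symm.trans e).trans
      ((trivializationAt F₂ E₂ x₀).continuousLinearEquivAt 𝕜 x₀ m₂), rfl⟩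
  refine (ContDiffAt.comp_contMDiffAt (g := ContinuousLinearMap.inverse) (x := x₀)
    (f := fun x ↦ inCoordinates F₁ E₁ F₂ E₂ x₀ x x₀ x (ϕ x))
    hi.contDiffAt_map_inverse h.2).congr_of_eventuallyEq ?_
  filter_upwards [(trivializationAt F₁ E₁ x₀).open_baseSet.mem_nhds m₁,
    (trivializationAt F₂ E₂ x₀).open_baseSet.mem_nhds m₂] with x hx₁ hx₂
  simp only [Function.comp_apply]
  rw [inCoordinates_eq hx₂ hx₁, inCoordinates_eq hx₁ hx₂]
  obtain ⟨e, he⟩ := hinv x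
  rw [← he, inverse_equiv]
  symm
  exact inverse_equiv
    (((trivializationAt F₁ E₁ x₀).continuousLinearEquivAt 𝕜 x hx₁).symm.trans e |>.trans
      ((trivializationAt F₂ E₂ x₀).continuousLinearEquivAt 𝕜 x hx₂))

end HomBundle

namespace MagriLenard

open VectorField Bundle

/-! ### Differentials, and the Lie bracket as a commutator of derivations. -/

section Bracket
variable {E : Type*} [NormedAddCommGroup E] [NormedSpace ℝ E]
variable {M : Type*} [TopologicalSpace M] [ChartedSpace E M] [IsManifold 𝓘(ℝ, E) ∞ M]

theorem SmoothOneForm.differential {f : M → ℝ} (hf : ContMDiff 𝓘(ℝ, E) 𝓘(ℝ, ℝ) ∞ f) :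
    SmoothOneForm (differential (E := E) f) := by
  intro x₀
  refine (contMDiffAt_hom_bundle _).2 ⟨contMDiffAt_id, ?_⟩
  refine ((hf x₀).mfderiv_const (m := ∞) (by simp)).congr_of_eventuallyEq (.of_forall fun x ↦ ?_)
  have h₁ := Trivial.continuousLinearMapAt_trivialization ℝ M ℝ x
  have h₂ := TangentBundle.continuousLinearMapAt_model_space (𝕜 := ℝ) (f x₀) (f x)
  simp only [ContinuousLinearMap.inCoordinates, inTangentCoordinates, h₂]
  refine (congrArg (fun A : ℝ →L[ℝ] ℝ ↦ A.comp _) h₁).trans ?_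
  rfl

theorem SmoothOneForm.pair {θ : OneForm E M} {V : VectorField E M} (hθ : SmoothOneForm θ)
    (hV : SmoothVectorField V) : ContMDiff 𝓘(ℝ, E) 𝓘(ℝ, ℝ) ∞ (θ.pair V) := by
  intro x
  have h := ContMDiff.clm_bundle_apply hθ hV x
  exact ((Bundle.contMDiffAt_totalSpace).1 h).2

theorem dirDeriv_extChartAt_symm (x : M) {g : M → ℝ}
    (hg : ContMDiff 𝓘(ℝ, E) 𝓘(ℝ, ℝ) ∞ g) (U : VectorField E M) {y : E}
    (hy : y ∈ (extChartAt 𝓘(ℝ, E) x).target) :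
    dirDeriv U g ((extChartAt 𝓘(ℝ, E) x).symm y) =
      fderiv ℝ (g ∘ (extChartAt 𝓘(ℝ, E) x).symm) y
        (mpullbackWithin 𝓘(ℝ, E) 𝓘(ℝ, E) (extChartAt 𝓘(ℝ, E) x).symm U
          (Set.range 𝓘(ℝ, E)) y) := by
  have hinv := isInvertible_mfderivWithin_extChartAt_symm hy
  have h₁ : HasMFDerivAt 𝓘(ℝ, E) 𝓘(ℝ, E) (extChartAt 𝓘(ℝ, E) x).symm y
      (mfderivWithin 𝓘(ℝ, E) 𝓘(ℝ, E) (extChartAt 𝓘(ℝ, E) x).symm (Set.range 𝓘(ℝ, E)) y) := by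
    have := (mdifferentiableWithinAt_extChartAt_symm hy).hasMFDerivWithinAt
    exact this.hasMFDerivAt (by simp)
  have h₂ := ((hg.mdifferentiable (by simp)
    ((extChartAt 𝓘(ℝ, E) x).symm y)).hasMFDerivAt.comp y h₁).mfderiv
  rw [mfderiv_eq_fderiv] at h₂
  rw [h₂, mpullbackWithin_apply]
  exact (congrArg (mfderiv 𝓘(ℝ, E) 𝓘(ℝ, ℝ) g _) (hinv.self_apply_inverse _)).symm

theorem SmoothVectorField.dirDeriv {V : VectorField E M} {f : M → ℝ} (hV : SmoothVectorField V)
    (hf : ContMDiff 𝓘(ℝ, E) 𝓘(ℝ, ℝ) ∞ f) : ContMDiff 𝓘(ℝ, E) 𝓘(ℝ, ℝ) ∞ (dirDeriv V f) :=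
  (SmoothOneForm.differential hf).pair hV

theorem SmoothVectorField.mdifferentiableAt {V : VectorField E M} (hV : SmoothVectorField V)
    (x : M) : MDifferentiableAt 𝓘(ℝ, E) (𝓘(ℝ, E).prod 𝓘(ℝ, E))
    (fun x ↦ TotalSpace.mk' E (E := fun x : M ↦ TangentSpace 𝓘(ℝ, E) x) x (V x)) x :=
  (ContMDiff.mdifferentiable hV (by simp)) x

/-- Read in the chart at `x`, both iterated derivatives contain the second derivative of `f`; its
symmetry leaves only the bracket term. -/
theorem dirDeriv_bracket [CompleteSpace E] {V W : VectorField E M} {f : M → ℝ}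
    (hV : SmoothVectorField V) (hW : SmoothVectorField W) (hf : ContMDiff 𝓘(ℝ, E) 𝓘(ℝ, ℝ) ∞ f) (x : M) :
    dirDeriv (bracket V W) f x = dirDeriv V (dirDeriv W f) x - dirDeriv W (dirDeriv V f) x := by
  have h2 : (2 : WithTop ℕ∞) ≤ ∞ := WithTop.coe_le_coe.2 le_top
  have : IsManifold 𝓘(ℝ, E) 2 M := .of_le h2
  set φ := extChartAt 𝓘(ℝ, E) x
  have hx : φ x ∈ φ.target := mem_extChartAt_target x
  have hxx : φ.symm (φ x) = x := extChartAt_to_inv x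
  let P (U : VectorField E M) : E → E :=
    mpullbackWithin 𝓘(ℝ, E) 𝓘(ℝ, E) φ.symm U (Set.range 𝓘(ℝ, E))
  have hP {U : VectorField E M} (hU : SmoothVectorField U) : DifferentiableAt ℝ (P U) (φ x) := by
    refine ((hU.mdifferentiableAt x).mdifferentiableWithinAt
      (s := Set.univ)).differentiableWithinAt_mpullbackWithin_vectorField.differentiableAt ?_
    simp
  have h₁ {U : VectorField E M} (hU : SmoothVectorField U) {g : M → ℝ}
      (hg : ContMDiff 𝓘(ℝ, E) 𝓘(ℝ, ℝ) ∞ g) :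
      dirDeriv U g x = fderiv ℝ (g ∘ φ.symm) (φ x) (P U (φ x)) := by
    rw [← dirDeriv_extChartAt_symm x hg U hx, hxx]
  have h₂ {U U' : VectorField E M} (hU : SmoothVectorField U) (hU' : SmoothVectorField U') :
      dirDeriv U' (dirDeriv U f) x =
        fderiv ℝ (fun y ↦ fderiv ℝ (f ∘ φ.symm) y (P U y)) (φ x) (P U' (φ x)) := by
    rw [h₁ hU' (hU.dirDeriv hf)]
    congr 1
    apply Filter.EventuallyEq.fderiv_eq
    filter_upwards [(isOpen_extChartAt_target x).mem_nhds hx] with y hy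
    exact dirDeriv_extChartAt_symm x hf U hy
  have hf' : ContDiffAt ℝ ∞ (f ∘ φ.symm) (φ x) := by
    have := (hf.comp_contMDiffOn (contMDiffOn_extChartAt_symm (n := ∞) x))
    exact (this.contDiffOn).contDiffAt ((isOpen_extChartAt_target x).mem_nhds hx)
  rw [h₂ hV hW, h₂ hW hV, ← fderiv_apply_lieBracket hf' (by simpa using! h2) (hP hW) (hP hV)]
  -- The chart at `x` and its inverse have identity derivative at the base point, so the pullbacks
  -- defining the bracket do nothing there.
  have inverse_apply (A : E →L[ℝ] E) (hA : A = .id ℝ E) (u : E) : A.inverse u = u := by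
    simp [hA]
  have h₃ : (bracket V W x : E) = lieBracket ℝ (P V) (P W) (φ x) := by
    simp only [bracket, mlieBracket, mlieBracketWithin_apply]
    refine (inverse_apply _ mfderiv_extChartAt_self _).trans ?_
    change lieBracketWithin ℝ (P V) (P W) (φ.symm ⁻¹' Set.univ ∩ Set.range 𝓘(ℝ, E)) (φ x) = _
    rw [show φ.symm ⁻¹' Set.univ ∩ Set.range 𝓘(ℝ, E) = Set.univ by simp, lieBracketWithin_univ]
  have h₄ : (P (bracket V W) (φ x) : E) = bracket V W x :=
    (inverse_apply _ mfderivWithin_range_extChartAt_symm _).trans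
      (congrArg (fun z ↦ (bracket V W z : E)) hxx)
  have h₅ := dirDeriv_extChartAt_symm x hf (bracket V W) hx
  rw [← h₃, ← h₄, ← h₅, hxx]

/-- A linear function in the chart at `x`, cut off by a bump function equal to `1` near `x`.
Hausdorffness makes the extension by zero smooth. -/
theorem exists_differential_eq [FiniteDimensional ℝ E] [T2Space M] (x : M)
    (α : TangentSpace 𝓘(ℝ, E) x →L[ℝ] ℝ) :
    ∃ f : M → ℝ, ContMDiff 𝓘(ℝ, E) 𝓘(ℝ, ℝ) ∞ f ∧ differential (E := E) f x = α := by
  obtain ⟨φ⟩ : Nonempty (SmoothBumpFunction 𝓘(ℝ, E) x) := inferInstance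
  let α' : E →L[ℝ] ℝ := α
  let g : M → ℝ := fun y => α' (extChartAt 𝓘(ℝ, E) x y)
  have hg : ContMDiffOn 𝓘(ℝ, E) 𝓘(ℝ, ℝ) ∞ g (chartAt E x).source :=
    α'.contDiff.contMDiff.comp_contMDiffOn (contMDiffOn_extChartAt)
  refine ⟨fun y => φ y • g y, φ.contMDiff_smul hg, ?_⟩
  have h1 : (fun y => φ y • g y) =ᶠ[nhds x] g := by
    filter_upwards [φ.eventuallyEq_one] with y hy
    simp [hy]
  have h2 : HasMFDerivAt 𝓘(ℝ, E) 𝓘(ℝ, E) (extChartAt 𝓘(ℝ, E) x) x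
      (ContinuousLinearMap.id ℝ _) := by
    rw [← mfderiv_extChartAt_self]
    exact (mdifferentiableAt_extChartAt (mem_chart_source E x)).hasMFDerivAt
  have h3 : HasMFDerivAt 𝓘(ℝ, E) 𝓘(ℝ, ℝ) α' (extChartAt 𝓘(ℝ, E) x x) α' := α'.hasMFDerivAt
  have h4 := (h3.comp x h2)
  have := (h4.congr_of_eventuallyEq h1).mfderiv
  exact this.trans (ContinuousLinearMap.ext fun v => rfl)
end Bracket

/-! ### Smoothness of the pointwise operations; hamiltonian vector fields. -/

section Smoothness
variable {E : Type*} [NormedAddCommGroup E] [NormedSpace ℝ E]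
variable {M : Type*} [TopologicalSpace M] [ChartedSpace E M]

theorem recursionOperator_apply {P₁ P₂ : CoTensorField E M} (hinv : ∀ x, (P₁ x).IsInvertible)
    (x : M) (α : TangentSpace 𝓘(ℝ, E) x →L[ℝ] ℝ) :
    recursionOperator P₁ P₂ x (P₁ x α) = P₂ x α :=
  congrArg (P₂ x) ((hinv x).inverse_apply_self α)

theorem tangent_ext {x : M} {u v : TangentSpace 𝓘(ℝ, E) x}
    (h : ∀ α : TangentSpace 𝓘(ℝ, E) x →L[ℝ] ℝ, α u = α v) : u = v :=
  (SeparatingDual.eq_iff_forall_dual_eq (R := ℝ) (V := E)).2 h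

theorem dirDeriv_neg (V : VectorField E M) (f : M → ℝ) (x : M) :
    dirDeriv V (fun y ↦ - f y) x = - dirDeriv V f x :=
  congrArg (fun A : E →L[ℝ] ℝ ↦ A (V x)) (mfderiv_neg (I := 𝓘(ℝ, E)) (f := f) (x := x))

theorem differential_add {f g : M → ℝ} (hf : ContMDiff 𝓘(ℝ, E) 𝓘(ℝ, ℝ) ∞ f)
    (hg : ContMDiff 𝓘(ℝ, E) 𝓘(ℝ, ℝ) ∞ g) (x : M) :
    differential (E := E) (fun y ↦ f y + g y) x = differential f x + differential g x :=
  mfderiv_add (hf.mdifferentiable (by simp) x) (hg.mdifferentiable (by simp) x)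

variable [IsManifold 𝓘(ℝ, E) ∞ M]

theorem SmoothEndField.act {R : EndField E M} {V : VectorField E M} (hR : SmoothEndField R)
    (hV : SmoothVectorField V) : SmoothVectorField (R.act V) :=
  ContMDiff.clm_bundle_apply hR hV

theorem SmoothCoTensorField.act {P : CoTensorField E M} {α : OneForm E M}
    (hP : SmoothCoTensorField P) (hα : SmoothOneForm α) : SmoothVectorField (P.act α) :=
  ContMDiff.clm_bundle_apply hP hα

theorem SmoothEndField.comp {R S : EndField E M} (hR : SmoothEndField R)
    (hS : SmoothEndField S) : SmoothEndField (R.comp S) :=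
  ContMDiff.clm_bundle_comp hR hS

theorem SmoothOneForm.mulEnd {θ : OneForm E M} {R : EndField E M} (hθ : SmoothOneForm θ)
    (hR : SmoothEndField R) : SmoothOneForm (θ.mulEnd R) :=
  ContMDiff.clm_bundle_comp hθ hR

theorem SmoothEndField.pow {R : EndField E M} (hR : SmoothEndField R) (k : ℕ) :
    SmoothEndField (R.pow k) := by
  induction k with
  | zero =>
    intro x₀
    refine (contMDiffAt_hom_bundle _).2 ⟨contMDiffAt_id, ?_⟩
    -- In a trivialization the identity field is the constant `id`.
    refine (contMDiffAt_const (c := ContinuousLinearMap.id ℝ E)).congr_of_eventuallyEq ?_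
    have m := FiberBundle.mem_baseSet_trivializationAt' (F := E)
      (E := fun x : M ↦ TangentSpace 𝓘(ℝ, E) x) x₀
    filter_upwards [(trivializationAt E (fun x : M ↦ TangentSpace 𝓘(ℝ, E) x)
      x₀).open_baseSet.mem_nhds m] with x hx
    rw [ContinuousLinearMap.inCoordinates_eq hx hx]
    ext v
    exact ((trivializationAt E (fun x : M ↦ TangentSpace 𝓘(ℝ, E) x) x₀).continuousLinearEquivAt
      ℝ x hx).apply_symm_apply v
  | succ k ih =>
    have : R.pow (k + 1) = R.comp (R.pow k) := funext fun x ↦ pow_succ' (R x) k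
    rw [this]
    exact hR.comp ih

theorem SmoothEndField.recursionOperator [CompleteSpace E] {P₁ P₂ : CoTensorField E M}
    (h₁ : SmoothCoTensorField P₁) (h₂ : SmoothCoTensorField P₂)
    (hinv : ∀ x, (P₁ x).IsInvertible) : SmoothEndField (recursionOperator P₁ P₂) :=
  ContMDiff.clm_bundle_comp h₂ (ContMDiff.clm_bundle_inverse hinv h₁)

theorem tangent_ext_dirDeriv [FiniteDimensional ℝ E] [T2Space M] {x : M} {V W : VectorField E M}
    (h : ∀ f : M → ℝ, ContMDiff 𝓘(ℝ, E) 𝓘(ℝ, ℝ) ∞ f → dirDeriv V f x = dirDeriv W f x) :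
    V x = W x := by
  refine tangent_ext fun α ↦ ?_
  obtain ⟨f, hf, rfl⟩ := exists_differential_eq x α
  exact h f hf

namespace IsPoissonBivector

variable {P : CoTensorField E M}

theorem smooth_poissonBracket (hP : IsPoissonBivector P) {f g : M → ℝ}
    (hf : ContMDiff 𝓘(ℝ, E) 𝓘(ℝ, ℝ) ∞ f) (hg : ContMDiff 𝓘(ℝ, E) 𝓘(ℝ, ℝ) ∞ g) :
    ContMDiff 𝓘(ℝ, E) 𝓘(ℝ, ℝ) ∞ (poissonBracket P f g) :=
  (hP.smooth.act (.differential hf)).dirDeriv hg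

theorem poissonBracket_swap (hP : IsPoissonBivector P) (f g : M → ℝ) :
    poissonBracket P f g = fun x ↦ - poissonBracket P g f x :=
  funext fun x ↦ hP.skew x _ _

/-- Tangent vectors are separated by derivatives of global smooth functions; applied to a test
function `h`, both sides agree by Jacobi and antisymmetry. -/
theorem bracket_act_differential [FiniteDimensional ℝ E] [T2Space M]
    (hP : IsPoissonBivector P) {f g : M → ℝ}
    (hf : ContMDiff 𝓘(ℝ, E) 𝓘(ℝ, ℝ) ∞ f) (hg : ContMDiff 𝓘(ℝ, E) 𝓘(ℝ, ℝ) ∞ g) (x : M) :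
    bracket (P.act (differential f)) (P.act (differential g)) x =
      P x (differential (poissonBracket P f g) x) := by
  have : CompleteSpace E := FiniteDimensional.complete ℝ E
  refine tangent_ext_dirDeriv (W := P.act (differential (poissonBracket P f g))) fun h hh ↦ ?_
  rw [dirDeriv_bracket (hP.smooth.act (.differential hf)) (hP.smooth.act (.differential hg)) hh]
  change poissonBracket P f (poissonBracket P g h) x - poissonBracket P g (poissonBracket P f h) x
    = poissonBracket P (poissonBracket P f g) h x
  have h₁ := hP.jacobi f g h hf hg hh x
  have h₂ : poissonBracket P g (poissonBracket P h f) x =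
      - poissonBracket P g (poissonBracket P f h) x := by
    rw [hP.poissonBracket_swap h f]
    exact dirDeriv_neg _ _ x
  have h₃ := congrFun (hP.poissonBracket_swap (poissonBracket P f g) h) x
  beta_reduce at h₃
  linarith

end IsPoissonBivector
end Smoothness

/-! ### Tensoriality of the Nijenhuis torsion and of `L_X R`. -/

section Tensoriality
variable {E : Type*} [NormedAddCommGroup E] [NormedSpace ℝ E] [FiniteDimensional ℝ E]
variable {M : Type*} [TopologicalSpace M] [ChartedSpace E M] [IsManifold 𝓘(ℝ, E) ∞ M]

omit [FiniteDimensional ℝ E] in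
theorem SmoothEndField.mdifferentiableAt_act {R : EndField E M} (hR : SmoothEndField R)
    {V : VectorField E M} {x : M}
    (hV : MDifferentiableAt 𝓘(ℝ, E) (𝓘(ℝ, E).prod 𝓘(ℝ, E))
      (fun x ↦ TotalSpace.mk' E (E := fun x : M ↦ TangentSpace 𝓘(ℝ, E) x) x (V x)) x) :
    MDifferentiableAt 𝓘(ℝ, E) (𝓘(ℝ, E).prod 𝓘(ℝ, E))
      (fun x ↦ TotalSpace.mk' E (E := fun x : M ↦ TangentSpace 𝓘(ℝ, E) x) x (R.act V x)) x :=
  MDifferentiableAt.clm_bundle_apply (ContMDiff.mdifferentiable hR (by simp) x) hV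

omit [FiniteDimensional ℝ E] [IsManifold 𝓘(ℝ, E) ∞ M] in
theorem EndField.act_smul (R : EndField E M) (f : M → ℝ) (V : VectorField E M) :
    R.act (f • V) = f • R.act V :=
  funext fun x ↦ (R x).map_smul (f x) (V x)

omit [FiniteDimensional ℝ E] [IsManifold 𝓘(ℝ, E) ∞ M] in
theorem EndField.act_add (R : EndField E M) (V W : VectorField E M) :
    R.act (V + W) = R.act V + R.act W :=
  funext fun x ↦ (R x).map_add (V x) (W x)

/-- The terms containing derivatives of the scalar factor cancel. The second slot follows by
antisymmetry. -/
theorem tensorialAt_nijenhuisTorsion {R : EndField E M} (hR : SmoothEndField R)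
    (W : VectorField E M) (x : M) :
    TensorialAt 𝓘(ℝ, E) E (fun V : VectorField E M ↦ nijenhuisTorsion R V W x) x := by
  have : IsManifold 𝓘(ℝ, E) 2 M := .of_le (n := ∞) (WithTop.coe_le_coe.2 le_top)
  have : CompleteSpace E := FiniteDimensional.complete ℝ E
  constructor
  · intro f V hf hV
    have hRV := hR.mdifferentiableAt_act hV
    simp only [nijenhuisTorsion, EndField.act_smul, bracket]
    simp only [EndField.act]
    rw [mlieBracket_smul_left hf hRV, mlieBracket_smul_left hf hRV, mlieBracket_smul_left hf hV,
      mlieBracket_smul_left hf hV]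
    simp only [map_add, map_smul, EndField.act, smul_add, smul_sub]
    abel
  · intro V V' hV hV'
    have hRV := hR.mdifferentiableAt_act hV
    have hRV' := hR.mdifferentiableAt_act hV'
    simp only [nijenhuisTorsion, EndField.act_add, bracket]
    simp only [EndField.act]
    rw [mlieBracket_add_left hRV hRV', mlieBracket_add_left hRV hRV', mlieBracket_add_left hV hV',
      mlieBracket_add_left hV hV']
    simp only [map_add]
    abel

theorem tensorialAt_lieDerivative {R : EndField E M} (hR : SmoothEndField R)
    (X : VectorField E M) (x : M) :
    TensorialAt 𝓘(ℝ, E) E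
      (fun V : VectorField E M ↦ bracket X (R.act V) x - R.act (bracket X V) x) x := by
  have : IsManifold 𝓘(ℝ, E) 2 M := .of_le (n := ∞) (WithTop.coe_le_coe.2 le_top)
  have : CompleteSpace E := FiniteDimensional.complete ℝ E
  constructor
  · intro f V hf hV
    have hRV := hR.mdifferentiableAt_act hV
    simp only [EndField.act_smul, bracket]
    simp only [EndField.act]
    rw [mlieBracket_smul_right hf hRV, mlieBracket_smul_right hf hV]
    simp only [map_add, map_smul, EndField.act, smul_sub]
    abel
  · intro V V' hV hV'
    have hRV := hR.mdifferentiableAt_act hV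
    have hRV' := hR.mdifferentiableAt_act hV'
    simp only [EndField.act_add, bracket]
    simp only [EndField.act]
    rw [mlieBracket_add_right hRV hRV', mlieBracket_add_right hV hV']
    simp only [map_add]
    abel

omit [FiniteDimensional ℝ E] [IsManifold 𝓘(ℝ, E) ∞ M] in
theorem nijenhuisTorsion_swap (R : EndField E M) (V W : VectorField E M) (x : M) :
    nijenhuisTorsion R V W x = - nijenhuisTorsion R W V x := by
  simp only [nijenhuisTorsion, bracket, EndField.act]
  rw [mlieBracket_swap_apply, mlieBracket_swap_apply (V := R.act V) (W := W),
    mlieBracket_swap_apply (V := V) (W := R.act W),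
    mlieBracket_swap_apply (V := V) (W := W)]
  simp only [map_neg]
  abel

end Tensoriality

/-! ### Powers of a Nijenhuis tensor and hierarchies of closed forms. -/

section Nijenhuis
variable {E : Type*} [NormedAddCommGroup E] [NormedSpace ℝ E]
variable {M : Type*} [TopologicalSpace M] [ChartedSpace E M] [IsManifold 𝓘(ℝ, E) ∞ M]

omit [IsManifold 𝓘(ℝ, E) ∞ M] in
theorem EndField.pow_succ_act (R : EndField E M) (k : ℕ) (V : VectorField E M) :
    (R.pow (k + 1)).act V = R.act ((R.pow k).act V) :=
  funext fun x ↦ congrArg (fun A : TangentSpace 𝓘(ℝ, E) x →L[ℝ] TangentSpace 𝓘(ℝ, E) x ↦ A (V x))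
    (pow_succ' (R x) k)

omit [IsManifold 𝓘(ℝ, E) ∞ M] in
theorem EndField.pow_zero_act (R : EndField E M) (V : VectorField E M) :
    (R.pow 0).act V = V := rfl

theorem IsNijenhuis.bracket_act_pow {R : EndField E M} (hR : IsNijenhuis R) {V W : VectorField E M}
    (hV : SmoothVectorField V) (hW : SmoothVectorField W) (l : ℕ) (x : M) :
    bracket (R.act V) ((R.pow l).act W) x =
      (R x ^ l) (bracket (R.act V) W x) + R x (bracket V ((R.pow l).act W) x)
        - (R x ^ (l + 1)) (bracket V W x) := by
  induction l with
  | zero => simp [EndField.pow_zero_act]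
  | succ l ih =>
    -- Vanishing torsion on the pair `V`, `R^l W` is exactly the passage from `l` to `l + 1`.
    have h := hR.2 V ((R.pow l).act W) hV ((hR.1.pow l).act hW) x
    rw [EndField.pow_succ_act]
    simp only [nijenhuisTorsion, EndField.act] at h ih ⊢
    simp only [pow_succ', mul_apply_eq_comp] at ih ⊢
    rw [ih] at h
    simp only [map_sub, map_add] at h ⊢
    rw [← sub_eq_zero, ← h]
    abel

/-- With `k = l` this is the vanishing torsion of `R^k`; with `V = W = X` it reduces commutation of
the hierarchy to brackets with `X`. -/
theorem IsNijenhuis.bracket_pow_pow {R : EndField E M} (hR : IsNijenhuis R) {V W : VectorField E M}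
    (hV : SmoothVectorField V) (hW : SmoothVectorField W) (k l : ℕ) (x : M) :
    bracket ((R.pow k).act V) ((R.pow l).act W) x =
      (R x ^ l) (bracket ((R.pow k).act V) W x) + (R x ^ k) (bracket V ((R.pow l).act W) x)
        - (R x ^ (k + l)) (bracket V W x) := by
  induction k with
  | zero => simp [EndField.pow_zero_act]
  | succ k ih =>
    have h := hR.bracket_act_pow ((hR.1.pow k).act hV) hW l x
    rw [EndField.pow_succ_act, h, ih, show k + 1 + l = k + l + 1 by omega]
    simp only [pow_succ', mul_apply_eq_comp, map_sub, map_add]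
    abel

theorem IsNijenhuis.pow {R : EndField E M} (hR : IsNijenhuis R) (k : ℕ) : IsNijenhuis (R.pow k) := by
  refine ⟨hR.1.pow k, fun V W hV hW x ↦ ?_⟩
  simp only [nijenhuisTorsion]
  rw [hR.bracket_pow_pow hV hW, pow_add]
  simp only [EndField.act, EndField.pow, mul_apply_eq_comp]
  abel

theorem IsNijenhuis.isHaantjes {R : EndField E M} (hR : IsNijenhuis R) : IsHaantjes R := by
  refine ⟨hR.1, fun V W hV hW x ↦ ?_⟩
  simp [haantjesTorsion, EndField.act, hR.2 _ _ hV hW, hR.2 _ _ (hR.1.act hV) hW,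
    hR.2 _ _ hV (hR.1.act hW), hR.2 _ _ (hR.1.act hV) (hR.1.act hW)]

omit [IsManifold 𝓘(ℝ, E) ∞ M] in
theorem OneForm.mulEnd_pow_succ (θ : OneForm E M) (R : EndField E M) (k : ℕ) :
    θ.mulEnd (R.pow (k + 1)) = (θ.mulEnd (R.pow k)).mulEnd R :=
  funext fun x ↦ congrArg (fun A : TangentSpace 𝓘(ℝ, E) x →L[ℝ] TangentSpace 𝓘(ℝ, E) x ↦
    (θ x).comp A) (pow_succ (R x) k)

/-- Add `d(θR)` on `(RV, W)` and on `(V, RW)` and subtract `dθ(RV, RW)`: what remains is `d(θR²)(V,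
W)` up to `θ` of the torsion. -/
theorem IsNijenhuis.isClosedForm_mulEnd_mulEnd {R : EndField E M} (hR : IsNijenhuis R)
    {θ : OneForm E M} (h₀ : IsClosedForm θ) (h₁ : IsClosedForm (θ.mulEnd R)) :
    IsClosedForm ((θ.mulEnd R).mulEnd R) := by
  refine ⟨h₁.1.mulEnd hR.1, fun V W hV hW x ↦ ?_⟩
  have hRV := hR.1.act hV
  have hRW := hR.1.act hW
  have e₀ := h₀.2 _ _ hRV hRW x
  have e₁ := h₁.2 _ _ hRV hW x
  have e₂ := h₁.2 _ _ hV hRW x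
  have e₃ := congrArg (θ x) (hR.2 V W hV hW x)
  simp only [nijenhuisTorsion, map_sub, map_add, map_zero] at e₃
  change dirDeriv V (θ.pair (R.act (R.act W))) x - dirDeriv W (θ.pair (R.act (R.act V))) x
    - θ x (R.act (R.act (bracket V W)) x) = 0
  change dirDeriv (R.act V) (θ.pair (R.act W)) x - dirDeriv W (θ.pair (R.act (R.act V))) x
    - θ x (R.act (bracket (R.act V) W) x) = 0 at e₁
  change dirDeriv V (θ.pair (R.act (R.act W))) x - dirDeriv (R.act W) (θ.pair (R.act V)) x
    - θ x (R.act (bracket V (R.act W)) x) = 0 at e₂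
  change dirDeriv (R.act V) (θ.pair (R.act W)) x - dirDeriv (R.act W) (θ.pair (R.act V)) x
    - θ x (bracket (R.act V) (R.act W) x) = 0 at e₀
  linarith

theorem IsNijenhuis.isClosedForm_mulEnd_pow {R : EndField E M} (hR : IsNijenhuis R)
    {θ : OneForm E M} (h₀ : IsClosedForm θ) (h₁ : IsClosedForm (θ.mulEnd R)) (k : ℕ) :
    IsClosedForm (θ.mulEnd (R.pow k)) := by
  -- Closedness propagates by a two-step recursion, so the induction carries two consecutive powers.
  suffices IsClosedForm (θ.mulEnd (R.pow k)) ∧ IsClosedForm (θ.mulEnd (R.pow (k + 1))) from this.1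
  induction k with
  | zero =>
    refine ⟨h₀, ?_⟩
    rw [OneForm.mulEnd_pow_succ]
    exact h₁
  | succ k ih =>
    refine ⟨ih.2, ?_⟩
    rw [OneForm.mulEnd_pow_succ _ _ (k + 1), OneForm.mulEnd_pow_succ _ _ k]
    refine hR.isClosedForm_mulEnd_mulEnd ih.1 ?_
    rw [← OneForm.mulEnd_pow_succ]
    exact ih.2

theorem isClosedForm_differential [CompleteSpace E] {f : M → ℝ}
    (hf : ContMDiff 𝓘(ℝ, E) 𝓘(ℝ, ℝ) ∞ f) :
    IsClosedForm (differential (E := E) f) := by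
  refine ⟨.differential hf, fun V W hV hW x ↦ ?_⟩
  have h := dirDeriv_bracket hV hW hf x
  change dirDeriv V (dirDeriv W f) x - dirDeriv W (dirDeriv V f) x - dirDeriv (bracket V W) f x = 0
  rw [h, sub_self]

end Nijenhuis

/-! ### Compatible Poisson pairs and the recursion operator. -/

section Compatible
variable {E : Type*} [NormedAddCommGroup E] [NormedSpace ℝ E] [FiniteDimensional ℝ E]
variable {M : Type*} [TopologicalSpace M] [T2Space M] [ChartedSpace E M]
  [IsManifold 𝓘(ℝ, E) ∞ M]
variable {P₁ P₂ : CoTensorField E M}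

theorem ArePoissonCompatible.bracket_add_bracket (hP : ArePoissonCompatible P₁ P₂) {f g : M → ℝ}
    (hf : ContMDiff 𝓘(ℝ, E) 𝓘(ℝ, ℝ) ∞ f) (hg : ContMDiff 𝓘(ℝ, E) 𝓘(ℝ, ℝ) ∞ g) (x : M) :
    bracket (P₁.act (differential f)) (P₂.act (differential g)) x
        + bracket (P₂.act (differential f)) (P₁.act (differential g)) x =
      P₁ x (differential (poissonBracket P₂ f g) x)
        + P₂ x (differential (poissonBracket P₁ f g) x) := by
  have : IsManifold 𝓘(ℝ, E) 2 M := .of_le (n := ∞) (WithTop.coe_le_coe.2 le_top)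
  have : CompleteSpace E := FiniteDimensional.complete ℝ E
  have d₁ {f : M → ℝ} (hf : ContMDiff 𝓘(ℝ, E) 𝓘(ℝ, ℝ) ∞ f) :=
    (hP.poisson₁.smooth.act (.differential hf)).mdifferentiableAt x
  have d₂ {f : M → ℝ} (hf : ContMDiff 𝓘(ℝ, E) 𝓘(ℝ, ℝ) ∞ f) :=
    (hP.poisson₂.smooth.act (.differential hf)).mdifferentiableAt x
  have h := hP.poisson_add.bracket_act_differential hf hg x
  have h₁ := hP.poisson₁.bracket_act_differential hf hg x
  have h₂ := hP.poisson₂.bracket_act_differential hf hg x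
  have hadd : poissonBracket (fun x ↦ P₁ x + P₂ x) f g =
      fun x ↦ poissonBracket P₁ f g x + poissonBracket P₂ f g x :=
    funext fun y ↦ (differential g y).map_add _ _
  rw [hadd, differential_add (hP.poisson₁.smooth_poissonBracket hf hg)
    (hP.poisson₂.smooth_poissonBracket hf hg)] at h
  change mlieBracket 𝓘(ℝ, E) (P₁.act (differential f) + P₂.act (differential f))
    (P₁.act (differential g) + P₂.act (differential g)) x = _ at h
  rw [mlieBracket_add_left (d₁ hf) (d₂ hf), mlieBracket_add_right (d₁ hg) (d₂ hg),
    mlieBracket_add_right (d₁ hg) (d₂ hg)] at h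
  simp only [bracket, add_apply, map_add] at h h₁ h₂ ⊢
  rw [h₁, h₂, ← sub_eq_zero] at h
  rw [← sub_eq_zero, ← h]
  abel

/-- The values at a point of the hamiltonian vector fields of global smooth functions exhaust the
tangent space, when the Poisson bivector is invertible. -/
theorem exists_act_differential_eq {P : CoTensorField E M} (hinv : ∀ x, (P x).IsInvertible) (x : M)
    (v : TangentSpace 𝓘(ℝ, E) x) : ∃ f : M → ℝ, ContMDiff 𝓘(ℝ, E) 𝓘(ℝ, ℝ) ∞ f ∧
      v = P.act (differential f) x := by
  obtain ⟨f, hf, h⟩ := exists_differential_eq x ((P x).inverse v)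
  exact ⟨f, hf, by rw [CoTensorField.act, h]; exact ((hinv x).self_apply_inverse v).symm⟩

omit [FiniteDimensional ℝ E] [T2Space M] [IsManifold 𝓘(ℝ, E) ∞ M] in
theorem recursionOperator_act (hinv : ∀ x, (P₁ x).IsInvertible) (α : OneForm E M) :
    (recursionOperator P₁ P₂).act (P₁.act α) = P₂.act α :=
  funext fun x ↦ recursionOperator_apply hinv x (α x)

theorem ArePoissonCompatible.isNijenhuis (hP : ArePoissonCompatible P₁ P₂)
    (hinv : ∀ x, (P₁ x).IsInvertible) : IsNijenhuis (recursionOperator P₁ P₂) := by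
  have : CompleteSpace E := FiniteDimensional.complete ℝ E
  have hR := SmoothEndField.recursionOperator hP.poisson₁.smooth hP.poisson₂.smooth hinv
  have smooth₁ {f : M → ℝ} (hf : ContMDiff 𝓘(ℝ, E) 𝓘(ℝ, ℝ) ∞ f) :=
    hP.poisson₁.smooth.act (.differential hf)
  refine ⟨hR, fun V W hV hW x ↦ ?_⟩
  obtain ⟨f, hf, hVf⟩ := exists_act_differential_eq hinv x (V x)
  obtain ⟨g, hg, hWg⟩ := exists_act_differential_eq hinv x (W x)
  -- Each slot is replaced by a hamiltonian field with the same value at `x`; the swap between them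
  -- leaves `g` before `f` below.
  rw [(tensorialAt_nijenhuisTorsion hR W x).pointwise (hV.mdifferentiableAt x)
    ((smooth₁ hf).mdifferentiableAt x) hVf, nijenhuisTorsion_swap,
    (tensorialAt_nijenhuisTorsion hR _ x).pointwise (hW.mdifferentiableAt x)
    ((smooth₁ hg).mdifferentiableAt x) hWg, neg_eq_zero]
  have h := hP.bracket_add_bracket hg hf x
  have h₁ := hP.poisson₁.bracket_act_differential hg hf x
  have h₂ := hP.poisson₂.bracket_act_differential hg hf x
  have e := recursionOperator_apply (P₂ := P₂) hinv x
  simp only [nijenhuisTorsion, recursionOperator_act hinv]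
  simp only [EndField.act]
  rw [h₁, h₂]
  -- `R` applied to the mixed identity gives the two middle torsion terms, which cancel the outer
  -- ones because `R P₁ = P₂`.
  have h' := congrArg (recursionOperator P₁ P₂ x) h
  simp only [map_add, e] at h' ⊢
  rw [← sub_eq_zero] at h'
  rw [← neg_eq_zero, ← h']
  abel

/-- A vector field which is hamiltonian for both bivectors leaves the recursion operator
invariant. -/
theorem ArePoissonCompatible.leavesEndInvariant (hP : ArePoissonCompatible P₁ P₂)
    (hinv : ∀ x, (P₁ x).IsInvertible) {H₁ H₂ : M → ℝ}
    (hH₁ : ContMDiff 𝓘(ℝ, E) 𝓘(ℝ, ℝ) ∞ H₁) (hH₂ : ContMDiff 𝓘(ℝ, E) 𝓘(ℝ, ℝ) ∞ H₂)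
    (h : P₁.act (differential H₁) = P₂.act (differential H₂)) :
    LeavesEndInvariant (P₁.act (differential H₁)) (recursionOperator P₁ P₂) := by
  have : CompleteSpace E := FiniteDimensional.complete ℝ E
  have hR := SmoothEndField.recursionOperator hP.poisson₁.smooth hP.poisson₂.smooth hinv
  intro V hV x
  obtain ⟨f, hf, hVf⟩ := exists_act_differential_eq hinv x (V x)
  have hf₁ := hP.poisson₁.smooth.act (.differential hf)
  refine ((tensorialAt_lieDerivative hR _ x).pointwise (hV.mdifferentiableAt x)
    (hf₁.mdifferentiableAt x) hVf).trans ?_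
  have h₁ := hP.poisson₁.bracket_act_differential hH₁ hf x
  have h₂ := hP.poisson₂.bracket_act_differential hH₂ hf x
  have e := recursionOperator_apply (P₂ := P₂) hinv x
  -- Both brackets are `X f`; this is where the two hamiltonian descriptions of `X` meet.
  have hp : poissonBracket P₁ H₁ f = poissonBracket P₂ H₂ f := by
    simp only [poissonBracket, h]
  rw [recursionOperator_act hinv, EndField.act, h₁, e, hp, h, h₂, sub_self]

omit [T2Space M] in
theorem IsPoissonBivector.leavesFormInvariant {P : CoTensorField E M} (hP : IsPoissonBivector P)
    {H : M → ℝ} (hH : ContMDiff 𝓘(ℝ, E) 𝓘(ℝ, ℝ) ∞ H) :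
    LeavesFormInvariant (P.act (differential H)) (differential H) := by
  have : CompleteSpace E := FiniteDimensional.complete ℝ E
  intro V hV x
  have hX := hP.smooth.act (.differential hH)
  -- By skew-symmetry `H` is constant along its own flow, so `X(V H) - [X, V] H = V(X H) = 0`.
  have h₀ : dirDeriv (P.act (differential H)) H = fun _ ↦ (0 : ℝ) := by
    funext y
    have := hP.skew y (differential H y) (differential H y)
    simp only [dirDeriv, CoTensorField.act]
    linarith
  have h := dirDeriv_bracket hX hV hH x
  rw [h₀] at h
  have h₁ : dirDeriv V (fun _ ↦ (0 : ℝ)) x = 0 :=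
    congrArg (fun A : E →L[ℝ] ℝ ↦ A (V x)) mfderiv_const
  rw [h₁, sub_zero] at h
  exact sub_eq_zero.2 h.symm

-- Paired with `β`, both sides equal `-α(P₂ β)`, by skew-symmetry of `P₁` and `P₂`.
omit [FiniteDimensional ℝ E] [T2Space M] in
theorem recursionOperator_apply_eq (h₁ : IsPoissonBivector P₁) (h₂ : IsPoissonBivector P₂)
    (hinv : ∀ x, (P₁ x).IsInvertible) (x : M) (α : TangentSpace 𝓘(ℝ, E) x →L[ℝ] ℝ) :
    recursionOperator P₁ P₂ x (P₁ x α) = P₁ x (α.comp (recursionOperator P₁ P₂ x)) := by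
  refine tangent_ext fun β ↦ ?_
  rw [h₁.skew x (α.comp _) β, ContinuousLinearMap.comp_apply, recursionOperator_apply hinv,
    recursionOperator_apply hinv, h₂.skew]

omit [FiniteDimensional ℝ E] [T2Space M] in
theorem recursionOperator_apply_eq' (h₁ : IsPoissonBivector P₁) (h₂ : IsPoissonBivector P₂)
    (hinv : ∀ x, (P₁ x).IsInvertible) (x : M) (α : TangentSpace 𝓘(ℝ, E) x →L[ℝ] ℝ) :
    recursionOperator P₁ P₂ x (P₂ x α) = P₂ x (α.comp (recursionOperator P₁ P₂ x)) := by
  rw [← recursionOperator_apply (P₂ := P₂) hinv x α,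
    ← recursionOperator_apply (P₂ := P₂) hinv x (α.comp _), recursionOperator_apply_eq h₁ h₂ hinv]

omit [FiniteDimensional ℝ E] [T2Space M] [IsManifold 𝓘(ℝ, E) ∞ M] in
theorem EndField.pow_act_act {P : CoTensorField E M} {R : EndField E M}
    (h : ∀ x α, R x (P x α) = P x (α.comp (R x))) (α : OneForm E M) (k : ℕ) :
    (R.pow k).act (P.act α) = P.act (α.mulEnd (R.pow k)) := by
  induction k with
  | zero => rfl
  | succ k ih =>
    rw [EndField.pow_succ_act, ih, OneForm.mulEnd_pow_succ]
    exact funext fun x ↦ h x _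

omit [FiniteDimensional ℝ E] [T2Space M] in
theorem IsNijenhuis.bracket_pow_act_eq_zero {R : EndField E M} (hR : IsNijenhuis R)
    {X : VectorField E M} (hX : SmoothVectorField X) (h : LeavesEndInvariant X R) (k l : ℕ)
    (x : M) : bracket ((R.pow k).act X) ((R.pow l).act X) x = 0 := by
  have hl (l : ℕ) : bracket X ((R.pow l).act X) x = 0 := by
    induction l with
    | zero => simp [EndField.pow_zero_act]
    | succ l ih =>
      have := h _ ((hR.1.pow l).act hX) x
      rw [EndField.act, ih, map_zero, sub_zero] at this
      rw [EndField.pow_succ_act, this]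
  have hk : bracket ((R.pow k).act X) X x = 0 := by
    rw [bracket, mlieBracket_swap_apply, neg_eq_zero]
    exact hl k
  rw [hR.bracket_pow_pow hX hX, hl, hk]
  simp

end Compatible

end MagriLenard

/-! ### Assembly of the Magri–Lenard complex. -/

open MagriLenard in
theorem mainTheorem7
    {E : Type*} [NormedAddCommGroup E] [NormedSpace ℝ E] [FiniteDimensional ℝ E]
    {M : Type*} [TopologicalSpace M] [T2Space M] [ChartedSpace E M] [IsManifold 𝓘(ℝ, E) ∞ M]
    (P₁ P₂ : MagriLenard.CoTensorField E M)
    (hP : MagriLenard.ArePoissonCompatible P₁ P₂)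
    (hinv : ∀ x : M, (P₁ x).IsInvertible)
    (H₁ H₂ : M → ℝ)
    (hH₁ : ContMDiff 𝓘(ℝ, E) 𝓘(ℝ, ℝ) ∞ H₁)
    (hH₂ : ContMDiff 𝓘(ℝ, E) 𝓘(ℝ, ℝ) ∞ H₂)
    (X : MagriLenard.VectorField E M)
    (hX₁ : X = P₁.act (MagriLenard.differential H₁))
    (hX₂ : X = P₂.act (MagriLenard.differential H₂))
    (R : MagriLenard.EndField E M)
    (hR : R = MagriLenard.recursionOperator P₁ P₂)
    (θ : MagriLenard.OneForm E M)
    (hθ : θ = MagriLenard.differential H₁) :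
    MagriLenard.IsMagriLenardComplex (fun i ↦ R.pow (i : ℕ)) X θ ∧
    (∀ k : ℕ, MagriLenard.IsNijenhuis (R.pow k) ∧ MagriLenard.IsHaantjes (R.pow k)) ∧
    (∀ k : ℕ, MagriLenard.SmoothVectorField ((R.pow k).act X) ∧
      MagriLenard.IsLocallyHamiltonian P₁ ((R.pow k).act X) ∧
      MagriLenard.IsLocallyHamiltonian P₂ ((R.pow k).act X)) ∧
    (∀ k l : ℕ, ∀ x : M,
      MagriLenard.bracket ((R.pow k).act X) ((R.pow l).act X) x = 0) ∧
    (∀ k : ℕ, MagriLenard.IsClosedForm (θ.mulEnd (R.pow k))) ∧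
    MagriLenard.LeavesFormInvariant X θ ∧
    MagriLenard.LeavesEndInvariant X R := by
  have : CompleteSpace E := FiniteDimensional.complete ℝ E
  have hN : IsNijenhuis R := hR ▸ hP.isNijenhuis hinv
  have hX : SmoothVectorField X := hX₁ ▸ hP.poisson₁.smooth.act (.differential hH₁)
  have hLR : LeavesEndInvariant X R := by
    rw [hX₁, hR]
    exact hP.leavesEndInvariant hinv hH₁ hH₂ (hX₁.symm.trans hX₂)
  have hLθ : LeavesFormInvariant X θ := by
    rw [hX₁, hθ]
    exact hP.poisson₁.leavesFormInvariant hH₁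
  have hbr := hN.bracket_pow_act_eq_zero hX hLR
  have hRP₁ : ∀ x α, R x (P₁ x α) = P₁ x (α.comp (R x)) :=
    hR ▸ recursionOperator_apply_eq hP.poisson₁ hP.poisson₂ hinv
  have hRP₂ : ∀ x α, R x (P₂ x α) = P₂ x (α.comp (R x)) :=
    hR ▸ recursionOperator_apply_eq' hP.poisson₁ hP.poisson₂ hinv
  -- `P₁ θ = X = P₂ dH₂ = R (P₁ dH₂) = P₁ (dH₂ R)`, and `P₁` is injective.
  have hθ' : θ = (differential H₂).mulEnd R := by
    funext x
    apply (hinv x).injective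
    have h₁ : P₁ x (θ x) = P₂ x (differential H₂ x) := by
      rw [hθ]
      exact congrFun (hX₁.symm.trans hX₂) x
    rw [h₁, OneForm.mulEnd, ← hRP₁, hR, recursionOperator_apply hinv]
  have hc₁ : IsClosedForm θ := hθ ▸ isClosedForm_differential hH₁
  -- Starting the hierarchy at `dH₂` rather than `θ` makes its first two members exact; `θ R^k` is
  -- then its member of index `k + 1`.
  have hc₂ := hN.isClosedForm_mulEnd_pow (isClosedForm_differential hH₂) (hθ' ▸ hc₁)
  have hcl (k : ℕ) : IsClosedForm (θ.mulEnd (R.pow k)) := by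
    have : θ.mulEnd (R.pow k) = (differential H₂).mulEnd (R.pow (k + 1)) := by
      rw [hθ']
      exact funext fun x ↦ congrArg ((differential H₂ x).comp ·) (pow_succ' (R x) k).symm
    rw [this]
    exact hc₂ (k + 1)
  refine ⟨⟨fun i ↦ hN.1.pow i, hX, hc₁.1, fun i hi x ↦ ?_, fun i j ↦ ?_, fun i j ↦ hbr i j,
    fun i j ↦ ?_⟩, fun k ↦ ⟨hN.pow k, (hN.pow k).isHaantjes⟩, fun k ↦ ⟨(hN.1.pow k).act hX,
    ⟨_, hcl k, ?_⟩, ⟨_, hc₂ k, ?_⟩⟩, hbr, hcl, hLθ, hLR⟩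
  · simp only [hi]
    rfl
  · exact funext fun x ↦ pow_mul_comm (R x) i j
  · have : (θ.mulEnd (R.pow i)).mulEnd (R.pow j) = θ.mulEnd (R.pow (i + j)) :=
      funext fun x ↦ congrArg ((θ x).comp ·) (pow_add (R x) i j).symm
    rw [this]
    exact hcl _
  · rw [hX₁, EndField.pow_act_act hRP₁, hθ]
  · rw [hX₂, EndField.pow_act_act hRP₂]
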